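/- For a complex $m\times m$ matrix $X$ let $\operatorname{Re}X=\tfrac12(X+X^*)$, let $\|X\|_p=\big(\sum_{j=1}^m\sigma_j(X)^p\big)^{1/p}$ be its Schatten $p$-norm, where $\sigma_1(X)\ge\dots\ge\sigma_m(X)$ are its singular values, and let $w_p(X)=\sup_{\theta\in\mathbb R}\|\operatorname{Re}(e^{i\theta}X)\|_p$. Let $p\in[2,\infty)$. Then the following hold. 1. For every $B\in M_n(\mathbb C)$, $$w_p\left(\begin{bmatrix}0&B\\B&0\end{bmatrix}\right)=2^{1/p}\,w_p(B).$$ 2. For all $A,B\in M_n(\mathbb C)$, $$w_p\left(\begin{bmatrix}A&B\\B&A\end{bmatrix}\right)\le 2^{1-\frac2p}\Big(w_p(A+B)^p+w_p(A-B)^p\Big)^{1/p},$$ and if $A$ and $B$ are Hermitian, then $$w_p\left(\begin{bmatrix}A&B\\B&A\end{bmatrix}\right)=\Big(w_p(A+B)^p+w_p(A-B)^p\Big)^{1/p}.$$ -/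

import Mathlib

open scoped ComplexStarModule

/-- The Schatten `p`-norm `(∑ⱼ σⱼ(A) ^ p) ^ (1 / p)` of a square complex matrix, where
`σ₀(A) ≥ σ₁(A) ≥ …` are the singular values of `A` with multiplicity (there are as many as the
size of `A`), i.e. those of the operator of `A` on the Euclidean space `ℂᵐ`. -/
noncomputable def schattenNorm {m : Type*} [Fintype m] [DecidableEq m] (p : ℝ)
    (A : Matrix m m ℂ) : ℝ :=
  (∑ j ∈ Finset.range (Fintype.card m),
    (Matrix.toEuclideanLin A).singularValues j ^ p) ^ (1 / p)

/-- The generalized numerical radius `w_N(A) = sup_{θ ∈ ℝ} N(Re(e^{iθ} A))`, where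
`Re X = (X + Xᴴ) / 2` is the Hermitian part of `X` (`ℜ` in Mathlib). -/
noncomputable def genNumericalRadius {m : Type*} [Fintype m] (N : Matrix m m ℂ → ℝ)
    (A : Matrix m m ℂ) : ℝ :=
  ⨆ θ : ℝ, N (ℜ (Complex.exp (θ * Complex.I) • A) : Matrix m m ℂ)

/-- `w_p`, the generalized numerical radius for the Schatten `p`-norm. -/
noncomputable def schattenNumericalRadius {m : Type*} [Fintype m] [DecidableEq m] (p : ℝ)
    (A : Matrix m m ℂ) : ℝ :=
  genNumericalRadius (schattenNorm p) A

open scoped Matrix.Norms.L2Operator in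
/-- The supremum that defines `w_p` is that of a bounded set, hence a genuine supremum. -/
theorem bddAbove_schattenNorm_realPart {m : Type*} [Fintype m] [DecidableEq m] {p : ℝ}
    (hp : 1 ≤ p) (A : Matrix m m ℂ) :
    BddAbove (Set.range fun θ : ℝ =>
      schattenNorm p (ℜ (Complex.exp (θ * Complex.I) • A) : Matrix m m ℂ)) := by
  have hσ : ∀ (X : Matrix m m ℂ) (j : ℕ), j ∈ Finset.range (Fintype.card m) →
      (Matrix.toEuclideanLin X).singularValues j ≤ ‖X‖ := by
    intro X j hj
    have hj' : j < Module.finrank ℂ (EuclideanSpace ℂ m) := by simpa using hj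
    set T := Matrix.toEuclideanLin X with hT
    obtain ⟨v, hv⟩ := (T.hasEigenvalue_adjoint_comp_self_sq_singularValues hj').exists_hasEigenvector
    have hv1 := hv.apply_eq_smul
    have hv0 : 0 < ‖v‖ := norm_pos_iff.mpr hv.2
    have h1 : ‖T v‖ ^ 2 = (T.singularValues j * ‖v‖) ^ 2 := by
      have : inner ℂ v ((LinearMap.adjoint T ∘ₗ T) v) = inner ℂ (T v) (T v) := by
        simp [LinearMap.adjoint_inner_right]
      rw [hv1, inner_smul_right, inner_self_eq_norm_sq_to_K, inner_self_eq_norm_sq_to_K] at this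
      rw [mul_pow]
      exact_mod_cast this.symm
    have h2 : ‖T v‖ = T.singularValues j * ‖v‖ :=
      (pow_left_inj₀ (norm_nonneg _) (mul_nonneg (T.singularValues_nonneg j) hv0.le)
        two_ne_zero).1 h1
    have h3 : ‖T v‖ ≤ ‖X‖ * ‖v‖ := Matrix.l2_opNorm_mulVec X v
    rw [h2] at h3
    exact le_of_mul_le_mul_right h3 hv0
  refine ⟨(∑ j ∈ Finset.range (Fintype.card m), ‖A‖ ^ p) ^ (1 / p), ?_⟩
  rintro _ ⟨θ, rfl⟩
  have hX : ‖(ℜ (Complex.exp (θ * Complex.I) • A) : Matrix m m ℂ)‖ ≤ ‖A‖ := by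
    have h : ‖Complex.exp (θ * Complex.I) • A‖ = ‖A‖ := by
      rw [norm_smul, Complex.norm_exp_ofReal_mul_I, one_mul]
    have h' : ‖star (Complex.exp (θ * Complex.I) • A)‖ = ‖A‖ := by
      rw [norm_star, h]
    rw [realPart_apply_coe, norm_smul]
    have := norm_add_le (Complex.exp (θ * Complex.I) • A) (star (Complex.exp (θ * Complex.I) • A))
    rw [h, h'] at this
    rw [Real.norm_of_nonneg (by norm_num : (0 : ℝ) ≤ 2⁻¹)]
    linarith
  unfold schattenNorm
  refine Real.rpow_le_rpow (Finset.sum_nonneg fun j _ => Real.rpow_nonneg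
    (LinearMap.singularValues_nonneg _ _) _) (Finset.sum_le_sum fun j hj => ?_) (by positivity)
  exact Real.rpow_le_rpow (LinearMap.singularValues_nonneg _ _) ((hσ _ j hj).trans hX)
    (by linarith)

/-! The Gram matrix of a block matrix with rows `(A, B)` and `(B, A)` has the same block shape, and
the sum and difference of its blocks are the Gram matrices of `A + B` and `A - B`. Such a matrix is
similar to a block triangular one, so its spectrum is the union of theirs and the `p`-th power of
the Schatten norm splits as a sum. Real parts preserve the shape, so this splitting holds at every
angle `θ`. Only the supremum over `θ` can lose equality: in general it yields `≤`, already with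
constant `1`. When `A = 0` the two summands agree at each `θ`, and in the Hermitian case all suprema
are attained at `θ = 0`. -/

open Matrix in
/-- The Schatten norm in terms of the roots of the characteristic polynomial of `Aᴴ * A`. -/
theorem schattenNorm_eq_sum_roots {m : Type*} [Fintype m] [DecidableEq m] (p : ℝ)
    (A : Matrix m m ℂ) :
    schattenNorm p A =
      ((Aᴴ * A).charpoly.roots.map fun z => z.re ^ (p / 2)).sum ^ (1 / p) := by
  have hn : Module.finrank ℂ (EuclideanSpace ℂ m) = Fintype.card m := by simp
  set T := Matrix.toEuclideanLin A with hT
  have hG : LinearMap.adjoint T ∘ₗ T = Matrix.toEuclideanLin (Aᴴ * A) := by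
    rw [hT, ← Matrix.toEuclideanLin_conjTranspose_eq_adjoint]
    ext v i
    simp [Matrix.toLpLin_apply, Matrix.mulVec_mulVec]
  have hc : (LinearMap.adjoint T ∘ₗ T).charpoly = (Aᴴ * A).charpoly := by
    rw [hG]
    exact (congrArg LinearMap.charpoly (congrFun (congrArg DFunLike.coe
      (Matrix.toLpLin_eq_toLin 2 2)) (Aᴴ * A))).trans (Matrix.charpoly_toLin _ _)
  unfold schattenNorm
  rw [← hc, T.isSymmetric_adjoint_comp_self.roots_charpoly_eq_eigenvalues hn, ← hT,
    Finset.sum_range]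
  congr 1
  rw [Multiset.map_map]
  refine Finset.sum_congr rfl fun i _ => ?_
  have h0 := T.singularValues_nonneg i
  simp only [Function.comp_apply]
  rw [← T.sq_singularValues_fin hn i]
  simp only [RCLike.ofReal_eq_complex_ofReal, Complex.ofReal_re]
  rw [← Real.rpow_natCast, ← Real.rpow_mul h0]
  congr 1
  push_cast
  ring

theorem schattenNorm_nonneg {m : Type*} [Fintype m] [DecidableEq m] (p : ℝ)
    (A : Matrix m m ℂ) : 0 ≤ schattenNorm p A :=
  Real.rpow_nonneg (Finset.sum_nonneg fun _ _ => Real.rpow_nonneg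
    (LinearMap.singularValues_nonneg _ _) _) _

open Matrix in
theorem schattenNorm_rpow {m : Type*} [Fintype m] [DecidableEq m] {p : ℝ} (hp : 0 < p)
    (A : Matrix m m ℂ) :
    schattenNorm p A ^ p = ((Aᴴ * A).charpoly.roots.map fun z => z.re ^ (p / 2)).sum := by
  have h : 0 ≤ ((Aᴴ * A).charpoly.roots.map fun z => z.re ^ (p / 2)).sum := by
    rw [(isHermitian_conjTranspose_mul_self A).roots_charpoly_eq_eigenvalues, Multiset.map_map]
    refine Finset.sum_nonneg fun i _ => Real.rpow_nonneg ?_ _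
    simpa using eigenvalues_conjTranspose_mul_self_nonneg A i
  rw [schattenNorm_eq_sum_roots, one_div, Real.rpow_inv_rpow h hp.ne']

namespace Matrix

theorem charpoly_fromBlocks_circulant {m R : Type*} [Fintype m] [DecidableEq m] [CommRing R]
    (P Q : Matrix m m R) :
    (fromBlocks P Q Q P).charpoly = (P + Q).charpoly * (P - Q).charpoly := by
  -- Conjugation by a unipotent matrix: add the second block row to the first, then subtract the
  -- first block column from the second. No division by `2` is needed.
  have h : fromBlocks (1 : Matrix m m R) 1 0 (1 : Matrix m m R) * fromBlocks P Q Q P *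
        fromBlocks (1 : Matrix m m R) (-1) 0 (1 : Matrix m m R) =
      fromBlocks (P + Q) 0 Q (P - Q) := by
    simp only [fromBlocks_multiply]
    congr 1 <;> simp <;> abel
  have h1 : fromBlocks (1 : Matrix m m R) (-1) 0 (1 : Matrix m m R) *
      fromBlocks (1 : Matrix m m R) 1 0 (1 : Matrix m m R) = 1 := by
    simp [fromBlocks_multiply]
  rw [← charpoly_fromBlocks_zero₁₂ _ Q, ← h, charpoly_mul_comm, ← mul_assoc, h1, one_mul]

theorem IsHermitian.roots_charpoly_smul {m : Type*} [Fintype m] [DecidableEq m]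
    {G : Matrix m m ℂ} (hG : G.IsHermitian) (c : ℂ) :
    (c • G).charpoly.roots = G.charpoly.roots.map (c * ·) := by
  have h : (c • G).charpoly =
      ∏ i, (Polynomial.X - Polynomial.C (c * (hG.eigenvalues i : ℂ))) := by
    -- Move the scalar onto the diagonal factor, then cancel the unitaries by cyclic invariance of
    -- `charpoly`.
    conv_lhs =>
      rw [hG.spectral_theorem, Unitary.conjStarAlgAut_apply, ← smul_mul_assoc, ← mul_smul_comm,
        charpoly_mul_comm, ← mul_assoc]
    simp [← diagonal_smul, charpoly_diagonal]
  rw [h, hG.roots_charpoly_eq_eigenvalues, Polynomial.roots_prod _ _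
    (Finset.prod_ne_zero_iff.2 fun i _ => Polynomial.X_sub_C_ne_zero _)]
  simp only [Polynomial.roots_X_sub_C, Multiset.map_map, Multiset.bind_singleton,
    Function.comp_def, RCLike.ofReal_eq_complex_ofReal]

end Matrix

open Matrix in
theorem schattenNorm_smul {m : Type*} [Fintype m] [DecidableEq m] {p : ℝ} (hp : 0 < p)
    (c : ℂ) (A : Matrix m m ℂ) : schattenNorm p (c • A) = ‖c‖ * schattenNorm p A := by
  rw [← Real.rpow_left_inj (schattenNorm_nonneg _ _)
    (mul_nonneg (norm_nonneg c) (schattenNorm_nonneg p A)) hp.ne',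
    Real.mul_rpow (norm_nonneg c) (schattenNorm_nonneg p A), schattenNorm_rpow hp,
    schattenNorm_rpow hp]
  have hH := isHermitian_conjTranspose_mul_self A
  have hG : (c • A)ᴴ * (c • A) = ((‖c‖ ^ 2 : ℝ) : ℂ) • (Aᴴ * A) := by
    rw [conjTranspose_smul, smul_mul_assoc, mul_smul_comm, smul_smul]
    congr 1
    rw [← starRingEnd_apply, mul_comm, Complex.mul_conj, Complex.normSq_eq_norm_sq]
  rw [hG, hH.roots_charpoly_smul, hH.roots_charpoly_eq_eigenvalues,
    Multiset.map_map, Multiset.map_map, Multiset.map_map, ← Multiset.sum_map_mul_left]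
  refine Finset.sum_congr rfl fun i _ => ?_
  have h0 := eigenvalues_conjTranspose_mul_self_nonneg A i
  simp only [Function.comp_apply, RCLike.ofReal_eq_complex_ofReal, ← Complex.ofReal_mul,
    Complex.ofReal_re]
  rw [Real.mul_rpow (by positivity) h0, ← Real.rpow_natCast, ← Real.rpow_mul (norm_nonneg c)]
  congr 2
  push_cast
  ring

open Matrix in
theorem schattenNorm_fromBlocks_rpow {m : Type*} [Fintype m] [DecidableEq m] {p : ℝ}
    (hp : 0 < p) (A B : Matrix m m ℂ) :
    schattenNorm p (fromBlocks A B B A) ^ p =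
      schattenNorm p (A + B) ^ p + schattenNorm p (A - B) ^ p := by
  have hG : (fromBlocks A B B A)ᴴ * fromBlocks A B B A =
      fromBlocks (Aᴴ * A + Bᴴ * B) (Aᴴ * B + Bᴴ * A) (Aᴴ * B + Bᴴ * A) (Aᴴ * A + Bᴴ * B) := by
    rw [fromBlocks_conjTranspose, fromBlocks_multiply]
    congr 1 <;> abel
  have h1 : Aᴴ * A + Bᴴ * B + (Aᴴ * B + Bᴴ * A) = (A + B)ᴴ * (A + B) := by
    rw [conjTranspose_add]; noncomm_ring
  have h2 : Aᴴ * A + Bᴴ * B - (Aᴴ * B + Bᴴ * A) = (A - B)ᴴ * (A - B) := by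
    rw [conjTranspose_sub]; noncomm_ring
  rw [schattenNorm_rpow hp, schattenNorm_rpow hp, schattenNorm_rpow hp, hG,
    charpoly_fromBlocks_circulant, h1, h2, Polynomial.roots_mul
      (mul_ne_zero (charpoly_monic _).ne_zero (charpoly_monic _).ne_zero),
    Multiset.map_add, Multiset.sum_add]

theorem Matrix.realPart_fromBlocks {m : Type*} [Fintype m] (A B : Matrix m m ℂ) :
    (ℜ (fromBlocks A B B A) : Matrix (m ⊕ m) (m ⊕ m) ℂ) =
      fromBlocks (ℜ A : Matrix m m ℂ) (ℜ B : Matrix m m ℂ) (ℜ B : Matrix m m ℂ)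
        (ℜ A : Matrix m m ℂ) := by
  simp only [realPart_apply_coe, star_eq_conjTranspose, fromBlocks_conjTranspose, fromBlocks_add,
    fromBlocks_smul]

theorem schattenNorm_realPart_fromBlocks_rpow {m : Type*} [Fintype m] [DecidableEq m] {p : ℝ}
    (hp : 0 < p) (c : ℂ) (A B : Matrix m m ℂ) :
    schattenNorm p (ℜ (c • Matrix.fromBlocks A B B A) : Matrix (m ⊕ m) (m ⊕ m) ℂ) ^ p =
      schattenNorm p (ℜ (c • (A + B)) : Matrix m m ℂ) ^ p +
        schattenNorm p (ℜ (c • (A - B)) : Matrix m m ℂ) ^ p := by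
  rw [Matrix.fromBlocks_smul, Matrix.realPart_fromBlocks, schattenNorm_fromBlocks_rpow hp,
    smul_add, smul_sub, map_add, map_sub, AddSubgroup.coe_add, AddSubgroup.coe_sub]

theorem schattenNorm_le_schattenNumericalRadius {m : Type*} [Fintype m] [DecidableEq m] {p : ℝ}
    (hp : 1 ≤ p) (A : Matrix m m ℂ) (θ : ℝ) :
    schattenNorm p (ℜ (Complex.exp (θ * Complex.I) • A) : Matrix m m ℂ) ≤
      schattenNumericalRadius p A :=
  le_ciSup (bddAbove_schattenNorm_realPart hp A) θ

theorem schattenNumericalRadius_nonneg {m : Type*} [Fintype m] [DecidableEq m] (p : ℝ)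
    (A : Matrix m m ℂ) : 0 ≤ schattenNumericalRadius p A :=
  Real.iSup_nonneg fun _ => schattenNorm_nonneg _ _

/-- At each `θ` the two summands are bounded separately by their own suprema, which may be attained
at different angles. -/
theorem schattenNumericalRadius_fromBlocks_le {m : Type*} [Fintype m] [DecidableEq m] {p : ℝ}
    (hp : 1 ≤ p) (A B : Matrix m m ℂ) :
    schattenNumericalRadius p (Matrix.fromBlocks A B B A) ≤
      (schattenNumericalRadius p (A + B) ^ p + schattenNumericalRadius p (A - B) ^ p) ^
        (1 / p) := by
  have hp0 : 0 < p := by linarith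
  refine ciSup_le fun θ => ?_
  rw [one_div, Real.le_rpow_inv_iff_of_pos (schattenNorm_nonneg _ _) (add_nonneg
    (Real.rpow_nonneg (schattenNumericalRadius_nonneg _ _) _)
    (Real.rpow_nonneg (schattenNumericalRadius_nonneg _ _) _)) hp0,
    schattenNorm_realPart_fromBlocks_rpow hp0]
  exact add_le_add
    (Real.rpow_le_rpow (schattenNorm_nonneg _ _) (schattenNorm_le_schattenNumericalRadius hp _ _)
      hp0.le)
    (Real.rpow_le_rpow (schattenNorm_nonneg _ _) (schattenNorm_le_schattenNumericalRadius hp _ _)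
      hp0.le)

theorem schattenNumericalRadius_fromBlocks_zero {m : Type*} [Fintype m] [DecidableEq m] {p : ℝ}
    (hp : 1 ≤ p) (B : Matrix m m ℂ) :
    schattenNumericalRadius p (Matrix.fromBlocks 0 B B 0) =
      2 ^ (1 / p) * schattenNumericalRadius p B := by
  have hp0 : 0 < p := by linarith
  have hN : ∀ X : Matrix m m ℂ, schattenNorm p (-X) = schattenNorm p X := fun X => by
    rw [← neg_one_smul ℂ, schattenNorm_smul hp0]
    simp
  unfold schattenNumericalRadius genNumericalRadius
  rw [Real.mul_iSup_of_nonneg (by positivity)]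
  refine congrArg iSup (funext fun θ => ?_)
  rw [← Real.rpow_left_inj (schattenNorm_nonneg _ _)
    (mul_nonneg (by positivity) (schattenNorm_nonneg _ _)) hp0.ne',
    schattenNorm_realPart_fromBlocks_rpow hp0, Real.mul_rpow (by positivity)
    (schattenNorm_nonneg _ _), one_div, Real.rpow_inv_rpow (by norm_num) hp0.ne', zero_add,
    zero_sub, smul_neg, map_neg, AddSubgroup.coe_neg, hN, two_mul]

/-- Here `Re(e^{iθ} A) = cos θ • A`, whose norm is largest at `θ = 0`. -/
theorem schattenNumericalRadius_of_isHermitian {m : Type*} [Fintype m] [DecidableEq m] {p : ℝ}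
    (hp : 1 ≤ p) {A : Matrix m m ℂ} (hA : A.IsHermitian) :
    schattenNumericalRadius p A = schattenNorm p A := by
  have hp0 : 0 < p := by linarith
  have hsa : IsSelfAdjoint A := hA
  refine le_antisymm (ciSup_le fun θ => ?_) ?_
  · have h : (ℜ (Complex.exp (θ * Complex.I) • A) : Matrix m m ℂ) = (Real.cos θ : ℂ) • A := by
      rw [realPart_smul, hsa.imaginaryPart, smul_zero, sub_zero, Complex.exp_ofReal_mul_I_re]
      rw [selfAdjoint.val_smul, hsa.coe_realPart, Complex.coe_smul]
    rw [h, schattenNorm_smul hp0, Complex.norm_real]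
    exact mul_le_of_le_one_left (schattenNorm_nonneg _ _) (Real.abs_cos_le_one θ)
  · simpa [hsa.coe_realPart] using schattenNorm_le_schattenNumericalRadius hp A 0

theorem Matrix.IsHermitian.schattenNumericalRadius_fromBlocks {m : Type*} [Fintype m]
    [DecidableEq m] {p : ℝ} (hp : 1 ≤ p) {A B : Matrix m m ℂ} (hA : A.IsHermitian)
    (hB : B.IsHermitian) :
    schattenNumericalRadius p (Matrix.fromBlocks A B B A) =
      (schattenNumericalRadius p (A + B) ^ p + schattenNumericalRadius p (A - B) ^ p) ^
        (1 / p) := by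
  have hp0 : 0 < p := by linarith
  rw [schattenNumericalRadius_of_isHermitian hp (hA.add hB),
    schattenNumericalRadius_of_isHermitian hp (hA.sub hB),
    schattenNumericalRadius_of_isHermitian hp (hA.fromBlocks hB.eq hA),
    ← schattenNorm_fromBlocks_rpow hp0, one_div,
    Real.rpow_rpow_inv (schattenNorm_nonneg _ _) hp0.ne']

theorem corollary4p5 (n : ℕ) (p : ℝ) (hp : 2 ≤ p) :
    (∀ B : Matrix (Fin n) (Fin n) ℂ,
      schattenNumericalRadius p (Matrix.fromBlocks 0 B B 0) =
        2 ^ (1 / p) * schattenNumericalRadius p B) ∧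
    (∀ A B : Matrix (Fin n) (Fin n) ℂ,
      schattenNumericalRadius p (Matrix.fromBlocks A B B A) ≤
        2 ^ (1 - 2 / p) *
          (schattenNumericalRadius p (A + B) ^ p +
            schattenNumericalRadius p (A - B) ^ p) ^ (1 / p)) ∧
    (∀ A B : Matrix (Fin n) (Fin n) ℂ, A.IsHermitian → B.IsHermitian →
      schattenNumericalRadius p (Matrix.fromBlocks A B B A) =
        (schattenNumericalRadius p (A + B) ^ p +
          schattenNumericalRadius p (A - B) ^ p) ^ (1 / p)) := by
  have hp1 : 1 ≤ p := by linarith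
  refine ⟨fun B => schattenNumericalRadius_fromBlocks_zero hp1 B, fun A B => ?_,
    fun A B hA hB => hA.schattenNumericalRadius_fromBlocks hp1 hB⟩
  refine (schattenNumericalRadius_fromBlocks_le hp1 A B).trans (le_mul_of_one_le_left ?_ ?_)
  · exact Real.rpow_nonneg (add_nonneg
      (Real.rpow_nonneg (schattenNumericalRadius_nonneg _ _) _)
      (Real.rpow_nonneg (schattenNumericalRadius_nonneg _ _) _)) _
  -- Since `p ≥ 2`, the exponent `1 - 2 / p` is nonnegative, so the stated factor only weakens the
  -- bound with constant `1`.
  · refine Real.one_le_rpow (by norm_num) ?_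
    rw [sub_nonneg, div_le_one (by linarith)]
    exact hp
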